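/- Let $c$ be the Banach space of convergent real sequences $x=(x(1),x(2),\dots)$ with the supremum norm, and write $x(0)=\lim_{n\to\infty}x(n)$. Let $f=(f(1),f(2),\dots)\in\ell_1$ (real scalars) act on $c$ by $$f(x)=\sum_{n=0}^{\infty} f(n+1)\,x(n),$$ and let $W_f=\{x\in c : f(x)=0\}$. Let $\ell_1$ act on $W_f$ by $g(x)=\sum_{n=1}^{\infty} g(n)x(n)$ for $g\in\ell_1$, $x\in W_f$, and let $\sigma(\ell_1,W_f)$ be the coarsest topology on $\ell_1$ for which $g\mapsto g(x)$ is continuous for every $x\in W_f$. We say that $\ell_1$ has the $\sigma(\ell_1,W_f)$-fixed point property ($\sigma(\ell_1,W_f)$-FPP) if, for every nonempty, convex, $\sigma(\ell_1,W_f)$-compact set $C\subset\ell_1$, every map $T:C\to C$ with $\|T(x)-T(y)\|_{\ell_1}\le\|x-y\|_{\ell_1}$ for all $x,y\in C$ has a fixed point. Suppose that $\|f\|_{\ell_1}=1$, $\tfrac12\le|f(1)|<1$ and $|f(j)|<\tfrac12$ for every $j\ge2$. Then $\ell_1$ has the $\sigma(\ell_1,W_f)$-FPP if and only if one of the following conditions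 holds: 1. $|f(1)|>\tfrac12$; 2. $|f(1)|=\tfrac12$ and the set $\{n\ge 1 : f(1)f(n+1)\le0\}$ is finite. -/

import Mathlib

open Filter Topology
open scoped ENNReal NNReal

namespace WeakStarFPP

noncomputable section

/-- The real Banach space `ℓ₁`; the entry with index `n` is the `(n + 1)`-st entry of the sequence. -/
abbrev Ell1 : Type := lp (fun _ : ℕ => ℝ) 1

/-- The real Banach space `ℓ_∞`. -/
abbrev EllInfty : Type := lp (fun _ : ℕ => ℝ) ∞

/-- The space `c` of convergent real sequences with the supremum norm, as a subspace of `ℓ_∞`. -/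
def ConvSeq : Submodule ℝ EllInfty where
  carrier := {x | ∃ l : ℝ, Tendsto (fun n => x n) atTop (𝓝 l)}
  add_mem' := by
    rintro x y ⟨a, ha⟩ ⟨b, hb⟩
    exact ⟨a + b, ha.add hb⟩
  zero_mem' := ⟨0, tendsto_const_nhds⟩
  smul_mem' := by
    rintro r x ⟨a, ha⟩
    exact ⟨r * a, ha.const_mul r⟩

/-- The limit of a convergent sequence. -/
def seqLim (x : ConvSeq) : ℝ := limUnder atTop (fun n => x.1 n)

theorem tendsto_seqLim (x : ConvSeq) : Tendsto (fun n => x.1 n) atTop (𝓝 (seqLim x)) :=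
  tendsto_nhds_limUnder x.2

theorem summable_ell1 (g : Ell1) : Summable fun n => ‖g n‖ := by
  have h := (lp.memℓp g).summable (by simp)
  simpa using h

theorem summable_mul (g : ℕ → ℝ) (hg : Summable fun n => ‖g n‖) (x : EllInfty) :
    Summable fun n => g n * x n := by
  refine Summable.of_norm_bounded (hg.mul_right ‖x‖) fun n => ?_
  rw [norm_mul]
  exact mul_le_mul_of_nonneg_left (lp.norm_apply_le_norm (by simp) x n) (norm_nonneg _)

theorem summable_shift (f : Ell1) : Summable fun n => ‖f (n + 1)‖ :=
  (summable_nat_add_iff 1).2 (summable_ell1 f)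

/-- The functional on `c` given by `f ∈ ℓ₁`: the first entry of `f` multiplies the limit of `x`,
and the `(n + 1)`-st entry of `f` multiplies the `n`-th entry of `x`, for `n ≥ 1`. -/
def cFunctional (f : Ell1) : ConvSeq →ₗ[ℝ] ℝ where
  toFun x := f 0 * seqLim x + ∑' n, f (n + 1) * x.1 n
  map_add' x y := by
    have h : seqLim (x + y) = seqLim x + seqLim y :=
      tendsto_nhds_unique (tendsto_seqLim (x + y)) ((tendsto_seqLim x).add (tendsto_seqLim y))
    have hs : ∑' n, f (n + 1) * (x + y).1 n
        = ∑' n, f (n + 1) * x.1 n + ∑' n, f (n + 1) * y.1 n := by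
      rw [← (summable_mul _ (summable_shift f) x.1).tsum_add
        (summable_mul _ (summable_shift f) y.1)]
      exact tsum_congr fun n => mul_add _ _ _
    rw [h, hs]
    ring
  map_smul' r x := by
    have h : seqLim (r • x) = r * seqLim x :=
      tendsto_nhds_unique (tendsto_seqLim (r • x)) ((tendsto_seqLim x).const_mul r)
    have hs : ∑' n, f (n + 1) * (r • x).1 n = r * ∑' n, f (n + 1) * x.1 n := by
      rw [← tsum_mul_left]
      exact tsum_congr fun n => mul_left_comm _ _ _
    rw [h, hs, RingHom.id_apply, smul_eq_mul]
    ring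

/-- The hyperplane `W_f = {x ∈ c : f(x) = 0}`. -/
def W (f : Ell1) : Submodule ℝ ConvSeq := LinearMap.ker (cFunctional f)

/-- The dual action of `ℓ₁` on `W_f`: `g(x) = ∑ g(n) x(n)`. -/
def pairing (f : Ell1) : Ell1 →ₗ[ℝ] W f →ₗ[ℝ] ℝ :=
  LinearMap.mk₂ ℝ (fun g x => ∑' n, g n * x.1.1 n)
    (fun g h x => by
      rw [← (summable_mul _ (summable_ell1 g) x.1.1).tsum_add
        (summable_mul _ (summable_ell1 h) x.1.1)]
      exact tsum_congr fun n => add_mul _ _ _)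
    (fun r g x => by
      rw [smul_eq_mul, ← tsum_mul_left]
      exact tsum_congr fun n => mul_assoc _ _ _)
    (fun g x y => by
      rw [← (summable_mul _ (summable_ell1 g) x.1.1).tsum_add
        (summable_mul _ (summable_ell1 g) y.1.1)]
      exact tsum_congr fun n => mul_add _ _ _)
    (fun r g x => by
      rw [smul_eq_mul, ← tsum_mul_left]
      exact tsum_congr fun n => mul_left_comm _ _ _)

/-- The topology `σ(ℓ₁, W_f)`: the coarsest topology on `ℓ₁` for which `g ↦ g(x)` is continuous for
every `x ∈ W_f`. -/
@[reducible] def sigmaTopology (f : Ell1) : TopologicalSpace Ell1 :=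
  WeakBilin.instTopologicalSpace (pairing f)

/-- Every nonexpansive self-map of `C` has a fixed point. -/
def HasFPP {X : Type*} [NormedAddCommGroup X] (C : Set X) : Prop :=
  ∀ T : C → C, (∀ x y : C, ‖(T x : X) - T y‖ ≤ ‖(x : X) - y‖) → ∃ x : C, T x = x

/-- `ℓ₁` has the `σ(ℓ₁, W_f)`-fixed point property. -/
def HasSigmaFPP (f : Ell1) : Prop :=
  ∀ C : Set Ell1, C.Nonempty → Convex ℝ C → @IsCompact Ell1 (sigmaTopology f) C → HasFPP C

end

end WeakStarFPP

/-!
If `f(0) ≠ 0`, then `W_f` consists of the `x ∈ c` with `lim x = ∑ e(n) x(n)`, where `e` is the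
`σ(ℓ₁, W_f)`-limit of the standard basis of `ℓ₁`, and `‖e‖ ≤ 1` when `‖f‖ ≤ 2 |f(0)|`. A bounded
net which converges coordinatewise to `z` and loses the mass `s` in the limit then has the
`σ(ℓ₁, W_f)`-limit `z + s • e`.

Take such a limit of approximate fixed points in a minimal invariant set `K`. By the Brezis–Lieb
property of `ℓ₁` and minimality, all points of `K` have the distance `‖s • e‖` from `z`. If
`‖e‖ < 1`, this leaves too little norm for the mass `s`. Otherwise equality in the triangle
inequality at the midpoints in `K` shows that the lost mass has the sign of `s * e(n)` at each `n`,
while it must escape to infinity with the sign of `s`; this is impossible if `e(n) < 0` for all but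
finitely many `n`. So `s = 0`, and `K` is a point.

If `‖e‖ = 1` and `e ≥ 0` along an infinite set of indices, the shift along these indices is an
isometry without fixed points on the closed convex hull of `e` and the corresponding basis vectors.
-/

namespace WeakStarFPP

noncomputable section

section AbsolutelySummable

variable {φ x : ℕ → ℝ} {B : ℝ} {N : ℕ}

theorem summable_mul_of_abs_le (hφ : Summable fun n => |φ n|) (hx : ∀ n, |x n| ≤ B) :
    Summable fun n => φ n * x n :=
  (hφ.mul_right B).of_norm_bounded fun n => by
    rw [norm_mul]
    exact mul_le_mul_of_nonneg_left (hx n) (abs_nonneg _)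

theorem abs_tsum_mul_le (hφ : Summable fun n => |φ n|) (hx : ∀ n, |x n| ≤ B) :
    |∑' n, φ n * x n| ≤ (∑' n, |φ n|) * B := by
  rw [← tsum_mul_right, ← Real.norm_eq_abs]
  refine tsum_of_norm_bounded (hφ.mul_right B).hasSum fun n => ?_
  rw [norm_mul]
  exact mul_le_mul_of_nonneg_left (hx n) (abs_nonneg _)

theorem abs_tsum_mul_sub_sum_le (hφ : Summable fun n => |φ n|) (hx : ∀ n, N ≤ n → |x n| ≤ B) :
    |∑' n, φ n * x n - ∑ n ∈ Finset.range N, φ n * x n| ≤ (∑' n, |φ (n + N)|) * B := by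
  have hφN : Summable fun n => |φ (n + N)| := (summable_nat_add_iff N).2 hφ
  have hxN (n : ℕ) : |x (n + N)| ≤ B := hx _ (Nat.le_add_left N n)
  have hs : Summable fun n => φ n * x n :=
    (summable_nat_add_iff N).1 (summable_mul_of_abs_le hφN hxN)
  rw [← hs.sum_add_tsum_nat_add N, add_sub_cancel_left]
  exact abs_tsum_mul_le hφN hxN

end AbsolutelySummable

namespace Ell1

theorem norm_eq_tsum_abs (g : Ell1) : ‖g‖ = ∑' n, |g n| := by
  simpa using lp.norm_eq_tsum_rpow (p := 1) (by simp) g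

theorem summable_abs (g : Ell1) : Summable fun n => |g n| := summable_ell1 g

theorem norm_eq_abs_add (g : Ell1) : ‖g‖ = |g 0| + ∑' n, |g (n + 1)| := by
  rw [norm_eq_tsum_abs, (summable_abs g).tsum_eq_zero_add]

theorem abs_apply_le_norm (g : Ell1) (n : ℕ) : |g n| ≤ ‖g‖ :=
  lp.norm_apply_le_norm one_ne_zero g n

/-- An absolutely summable sequence as an element of `ℓ₁`. -/
def ofSummable (u : ℕ → ℝ) (hu : Summable fun n => |u n|) : Ell1 :=
  ⟨u, memℓp_gen (by simpa using hu)⟩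

theorem coe_ofSummable (u : ℕ → ℝ) (hu : Summable fun n => |u n|) : ⇑(ofSummable u hu) = u :=
  rfl

/-- The total mass `∑ g(n)` of `g ∈ ℓ₁`, as a continuous linear functional. -/
def mass : Ell1 →L[ℝ] ℝ := lp.tsumCLM ℝ ℕ ℝ

theorem mass_apply (g : Ell1) : mass g = ∑' n, g n := rfl

theorem abs_mass_le_norm (g : Ell1) : |mass g| ≤ ‖g‖ := lp.norm_tsum_le g

theorem norm_eq_mass {g : Ell1} (hg : ∀ n, 0 ≤ g n) : ‖g‖ = mass g := by
  simp only [norm_eq_tsum_abs, mass_apply, abs_of_nonneg (hg _)]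

theorem mul_nonneg_of_norm_add_eq {g h : Ell1} (hgh : ‖g + h‖ = ‖g‖ + ‖h‖) (k : ℕ) :
    0 ≤ g k * h k := by
  have hle (n : ℕ) : |(g + h) n| ≤ |g n| + |h n| := abs_add_le _ _
  have heq : |g k + h k| = |g k| + |h k| := by
    by_contra hne
    have hlt := Summable.tsum_lt_tsum hle (lt_of_le_of_ne (hle k) hne) (summable_abs (g + h))
      ((summable_abs g).add (summable_abs h))
    rw [(summable_abs g).tsum_add (summable_abs h)] at hlt
    simp only [norm_eq_tsum_abs] at hgh
    exact hlt.ne hgh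
  rcases (abs_add_eq_add_abs_iff _ _).1 heq with ⟨hg, hh⟩ | ⟨hg, hh⟩
  · exact mul_nonneg hg hh
  · exact mul_nonneg_of_nonpos_of_nonpos hg hh

section CoordinatewiseLimits

variable {ι : Type*} {F : Filter ι} {x : ι → Ell1} {z : Ell1} {M : ℝ}

/-- The Brezis–Lieb property of `ℓ₁`. -/
theorem tendsto_norm_sub_sub_norm_sub (hx : ∀ k, Tendsto (fun i => x i k) F (𝓝 (z k)))
    (v : Ell1) : Tendsto (fun i => ‖x i - v‖ - ‖x i - z‖) F (𝓝 ‖z - v‖) := by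
  have heq (i : ι) : ‖x i - v‖ - ‖x i - z‖ = ∑' k, (|x i k - v k| - |x i k - z k|) := by
    rw [norm_eq_tsum_abs, norm_eq_tsum_abs,
      ← (summable_abs (x i - v)).tsum_sub (summable_abs (x i - z))]
    rfl
  simp only [heq, norm_eq_tsum_abs (z - v)]
  refine tendsto_tsum_of_dominated_convergence (summable_abs (z - v)) (fun k => ?_)
    (Eventually.of_forall fun i k => ?_)
  · simpa using ((hx k).sub_const (v k)).abs.sub ((hx k).sub_const (z k)).abs
  · calc |(|x i k - v k| - |x i k - z k|)| ≤ |x i k - v k - (x i k - z k)| :=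
        abs_abs_sub_abs_le_abs_sub _ _
      _ = |z k - v k| := by rw [sub_sub_sub_cancel_left]

theorem tendsto_tsum_mul_of_tendsto_zero (hM : ∀ᶠ i in F, ‖x i‖ ≤ M)
    (hx : ∀ k, Tendsto (fun i => x i k) F (𝓝 0)) {u : ℕ → ℝ} (hu : Tendsto u atTop (𝓝 0)) :
    Tendsto (fun i => ∑' k, x i k * u k) F (𝓝 0) := by
  refine Metric.tendsto_nhds.2 fun ε hε => ?_
  obtain ⟨η, hη, hMη⟩ : ∃ η > 0, M * η < ε / 2 := exists_pos_mul_lt (half_pos hε) M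
  obtain ⟨N, hN⟩ := eventually_atTop.1 (Metric.tendsto_nhds.1 hu η hη)
  have hhead : Tendsto (fun i => ∑ k ∈ Finset.range N, x i k * u k) F (𝓝 0) := by
    simpa using tendsto_finsetSum (Finset.range N) fun k _ => (hx k).mul_const (u k)
  filter_upwards [hM, Metric.tendsto_nhds.1 hhead (ε / 2) (half_pos hε)] with i hi hhead_i
  have htail : |∑' k, x i k * u k - ∑ k ∈ Finset.range N, x i k * u k| < ε / 2 := by
    calc |∑' k, x i k * u k - ∑ k ∈ Finset.range N, x i k * u k|
        ≤ (∑' k, |x i (k + N)|) * η := abs_tsum_mul_sub_sum_le (summable_abs (x i))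
          fun k hk => by simpa using (hN k hk).le
      _ ≤ ‖x i‖ * η := by
        gcongr
        rw [norm_eq_tsum_abs]
        exact tsum_comp_le_tsum_of_inj (summable_abs (x i)) (fun _ => abs_nonneg _)
          (add_left_injective N)
      _ ≤ M * η := by gcongr
      _ < ε / 2 := hMη
  rw [Real.dist_0_eq_abs] at hhead_i ⊢
  calc |∑' k, x i k * u k| ≤ |∑' k, x i k * u k - ∑ k ∈ Finset.range N, x i k * u k|
        + |∑ k ∈ Finset.range N, x i k * u k| := by
          simpa using abs_add_le (∑' k, x i k * u k - ∑ k ∈ Finset.range N, x i k * u k)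
            (∑ k ∈ Finset.range N, x i k * u k)
    _ < ε := by linarith

end CoordinatewiseLimits

end Ell1

theorem exists_tendsto_of_eventually_norm_le {ι E : Type*} [SeminormedAddCommGroup E]
    [ProperSpace E] (U : Ultrafilter ι) {u : ι → E} {M : ℝ} (hu : ∀ᶠ i in U, ‖u i‖ ≤ M) :
    ∃ l, Tendsto u U (𝓝 l) := by
  obtain ⟨l, -, hl⟩ := (isCompact_closedBall (0 : E) M).ultrafilter_le_nhds' (U.map u)
    (hu.mono fun _ hi => mem_closedBall_zero_iff.2 hi)
  exact ⟨l, hl⟩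

theorem Ell1.exists_coordinatewise_limit {ι : Type*} (U : Ultrafilter ι) {x : ι → Ell1} {M : ℝ}
    (hM : ∀ᶠ i in U, ‖x i‖ ≤ M) : ∃ (z : Ell1) (s : ℝ),
      (∀ k, Tendsto (fun i => x i k) U (𝓝 (z k))) ∧
      Tendsto (fun i => mass (x i - z)) U (𝓝 s) := by
  have hcoord (k : ℕ) : ∃ l, Tendsto (fun i => x i k) U (𝓝 l) :=
    exists_tendsto_of_eventually_norm_le U
      (hM.mono fun i hi => (abs_apply_le_norm (x i) k).trans hi)
  choose ζ hζ using hcoord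
  have hmass : ∃ l, Tendsto (fun i => mass (x i)) U (𝓝 l) :=
    exists_tendsto_of_eventually_norm_le U
      (hM.mono fun i hi => (abs_mass_le_norm (x i)).trans hi)
  obtain ⟨l, hl⟩ := hmass
  let z : Ell1 :=
    ⟨ζ, memℓp_gen' (lp.sum_rpow_le_of_tendsto ENNReal.one_ne_top hM (tendsto_pi_nhds.2 hζ))⟩
  refine ⟨z, l - mass z, hζ, ?_⟩
  simpa only [map_sub] using hl.sub_const (mass z)

theorem abs_apply_le_norm (x : ConvSeq) (n : ℕ) : |x.1 n| ≤ ‖x‖ :=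
  lp.norm_apply_le_norm ENNReal.top_ne_zero x.1 n

theorem abs_seqLim_le (x : ConvSeq) : |seqLim x| ≤ ‖x‖ :=
  le_of_tendsto (tendsto_seqLim x).abs (Eventually.of_forall (abs_apply_le_norm x))

theorem isClosed_convSeq : IsClosed (ConvSeq : Set EllInfty) := by
  refine isClosed_of_closure_subset fun x hx => ?_
  refine cauchySeq_tendsto_of_complete (Metric.cauchySeq_iff'.2 fun ε hε => ?_)
  obtain ⟨y, ⟨l, hl⟩, hxy⟩ := Metric.mem_closure_iff.1 hx (ε / 3) (by positivity)
  obtain ⟨N, hN⟩ := Metric.cauchySeq_iff'.1 hl.cauchySeq (ε / 3) (by positivity)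
  have hclose (n : ℕ) : dist (x n) (y n) < ε / 3 := by
    rw [dist_eq_norm] at hxy ⊢
    exact (lp.norm_apply_le_norm ENNReal.top_ne_zero (x - y) n).trans_lt hxy
  refine ⟨N, fun n hn => ?_⟩
  linarith [hclose n, hclose N, hN n hn, dist_triangle4 (x n) (y n) (y N) (x N),
    dist_comm (x N) (y N)]

instance : CompleteSpace ConvSeq := isClosed_convSeq.completeSpace_coe

section HyperplaneW

variable (f : Ell1)

theorem abs_cFunctional_le (x : ConvSeq) : |cFunctional f x| ≤ ‖f‖ * ‖x‖ := by
  calc |cFunctional f x| ≤ |f 0 * seqLim x| + |∑' n, f (n + 1) * x.1 n| := abs_add_le _ _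
    _ ≤ |f 0| * ‖x‖ + (∑' n, |f (n + 1)|) * ‖x‖ := by
      rw [abs_mul]
      gcongr
      · exact abs_seqLim_le x
      · exact abs_tsum_mul_le (summable_shift f) (abs_apply_le_norm x)
    _ = ‖f‖ * ‖x‖ := by rw [Ell1.norm_eq_abs_add f, add_mul]

instance : CompleteSpace (W f) :=
  ((cFunctional f).mkContinuous ‖f‖ (abs_cFunctional_le f)).isClosed_ker.completeSpace_coe

/-- The `σ(ℓ₁, W_f)`-limit `-f(n + 1) / f(0)` of the standard basis of `ℓ₁`, defined when
`f(0) ≠ 0`. -/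
def basisLimit : Ell1 :=
  Ell1.ofSummable (fun n => -f (n + 1) / f 0) (by
    simpa only [abs_div, abs_neg] using
      ((summable_nat_add_iff 1).2 (Ell1.summable_abs f)).div_const |f 0|)

theorem basisLimit_apply (n : ℕ) : basisLimit f n = -f (n + 1) / f 0 := rfl

theorem norm_basisLimit : ‖basisLimit f‖ = (‖f‖ - |f 0|) / |f 0| := by
  simp only [Ell1.norm_eq_tsum_abs (basisLimit f), basisLimit_apply, abs_div, abs_neg,
    tsum_div_const]
  rw [Ell1.norm_eq_abs_add f, add_sub_cancel_left]

variable {f}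

theorem norm_basisLimit_lt_one_iff (hf0 : f 0 ≠ 0) : ‖basisLimit f‖ < 1 ↔ ‖f‖ / 2 < |f 0| := by
  rw [norm_basisLimit, div_lt_one (abs_pos.2 hf0)]
  constructor <;> intro h <;> linarith

theorem norm_basisLimit_eq_one_iff (hf0 : f 0 ≠ 0) : ‖basisLimit f‖ = 1 ↔ |f 0| = ‖f‖ / 2 := by
  rw [norm_basisLimit, div_eq_one_iff_eq (abs_ne_zero.2 hf0)]
  constructor <;> intro h <;> linarith

theorem basisLimit_nonneg_iff (hf0 : f 0 ≠ 0) (n : ℕ) :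
    0 ≤ basisLimit f n ↔ f 0 * f (n + 1) ≤ 0 := by
  have h : basisLimit f n = -(f 0 * f (n + 1)) / f 0 ^ 2 := by
    rw [basisLimit_apply]
    field_simp
  rw [h, le_div_iff₀ (by positivity), zero_mul, neg_nonneg]

theorem mem_W_iff (hf0 : f 0 ≠ 0) (x : ConvSeq) :
    x ∈ W f ↔ ∑' n, basisLimit f n * x.1 n = seqLim x := by
  have hsum : ∑' n, basisLimit f n * x.1 n = -(∑' n, f (n + 1) * x.1 n) / f 0 := by
    rw [← tsum_neg, ← tsum_div_const]
    refine tsum_congr fun n => ?_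
    rw [basisLimit_apply]
    ring
  rw [hsum, div_eq_iff hf0, W, LinearMap.mem_ker]
  change f 0 * seqLim x + ∑' n, f (n + 1) * x.1 n = 0 ↔ _
  constructor <;> intro h <;> linarith

end HyperplaneW

section StepSequences

variable {φ a : ℕ → ℝ} {t : ℝ} {N : ℕ}

theorem tendsto_ite_lt (a : ℕ → ℝ) (t : ℝ) (N : ℕ) :
    Tendsto (fun n => if n < N then a n else t) atTop (𝓝 t) :=
  tendsto_const_nhds.congr' <| (eventually_ge_atTop N).mono fun _ hn => (if_neg hn.not_gt).symm

/-- The sequence in `c` which agrees with `a` below `N` and is equal to `t` from `N` on. -/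
def stepSeq (a : ℕ → ℝ) (t : ℝ) (N : ℕ) : ConvSeq :=
  ⟨⟨fun n => if n < N then a n else t, memℓp_infty (tendsto_ite_lt a t N).norm.bddAbove_range⟩,
    t, tendsto_ite_lt a t N⟩

theorem stepSeq_of_lt {n : ℕ} (hn : n < N) : (stepSeq a t N).1 n = a n := if_pos hn

theorem stepSeq_add (n : ℕ) : (stepSeq a t N).1 (n + N) = t := if_neg (by lia)

theorem seqLim_stepSeq : seqLim (stepSeq a t N) = t :=
  tendsto_nhds_unique (tendsto_seqLim (stepSeq a t N)) (tendsto_ite_lt a t N)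

theorem norm_stepSeq_le (ha : ∀ n, |a n| ≤ 1) (ht : |t| ≤ 1) : ‖stepSeq a t N‖ ≤ 1 :=
  lp.norm_le_of_forall_le zero_le_one fun n => by
    change |if n < N then a n else t| ≤ 1
    split_ifs
    exacts [ha n, ht]

theorem tsum_mul_stepSeq (hφ : Summable fun n => |φ n|) :
    ∑' n, φ n * (stepSeq a t N).1 n =
      ∑ k ∈ Finset.range N, φ k * a k + (∑' k, φ (k + N)) * t := by
  have hs := summable_mul_of_abs_le hφ (abs_apply_le_norm (stepSeq a t N))
  rw [← hs.sum_add_tsum_nat_add N, ← tsum_mul_right]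
  simp only [stepSeq_add]
  congr 1
  exact Finset.sum_congr rfl fun k hk => by rw [stepSeq_of_lt (Finset.mem_range.1 hk)]

theorem abs_sum_mul_le_sum_abs (ha : ∀ n, |a n| ≤ 1) (s : Finset ℕ) :
    |∑ k ∈ s, φ k * a k| ≤ ∑ k ∈ s, |φ k| := by
  refine (Finset.abs_sum_le_sum_abs _ _).trans (Finset.sum_le_sum fun k _ => ?_)
  rw [abs_mul]
  exact mul_le_of_le_one_right (abs_nonneg _) (ha k)

/-- A sequence prescribed below `N` extends to an element of the unit ball of `W_f`: the constant
value `t` from `N` on has to satisfy `t * (1 - tail) = head`. -/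
theorem exists_mem_W_extending {f : Ell1} (hf0 : f 0 ≠ 0) (he : ‖basisLimit f‖ ≤ 1)
    (hN : ∑' k, |basisLimit f (k + N)| < 1) (ha : ∀ n, |a n| ≤ 1) :
    ∃ w : W f, ‖w‖ ≤ 1 ∧ ∀ n < N, w.1.1 n = a n := by
  have hs := Ell1.summable_abs (basisLimit f)
  have hhead := abs_sum_mul_le_sum_abs (φ := basisLimit f) ha (Finset.range N)
  have htail : |∑' k, basisLimit f (k + N)| ≤ ∑' k, |basisLimit f (k + N)| :=
    norm_tsum_le_tsum_norm (f := fun k => basisLimit f (k + N)) ((summable_nat_add_iff N).2 hs)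
  rw [Ell1.norm_eq_tsum_abs, ← hs.sum_add_tsum_nat_add N] at he
  set head := ∑ k ∈ Finset.range N, basisLimit f k * a k
  set tail := ∑' k, basisLimit f (k + N)
  have hpos : 0 < 1 - tail := by linarith [le_abs_self tail]
  have ht : |head / (1 - tail)| ≤ 1 := by
    rw [abs_div, abs_of_pos hpos, div_le_one hpos]
    linarith [le_abs_self tail]
  have hmem : stepSeq a (head / (1 - tail)) N ∈ W f := by
    rw [mem_W_iff hf0, tsum_mul_stepSeq hs, seqLim_stepSeq]
    field_simp
    ring
  exact ⟨⟨_, hmem⟩, norm_stepSeq_le ha ht, fun n hn => stepSeq_of_lt hn⟩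

end StepSequences

section Duality

variable {f : Ell1}

theorem abs_pairing_le (g : Ell1) (w : W f) : |pairing f g w| ≤ ‖g‖ * ‖w‖ := by
  rw [Ell1.norm_eq_tsum_abs]
  exact abs_tsum_mul_le (Ell1.summable_abs g) (abs_apply_le_norm w.1)

theorem norm_le_iff_forall_abs_pairing_le (hf0 : f 0 ≠ 0) (he : ‖basisLimit f‖ ≤ 1) {g : Ell1}
    {r : ℝ} : ‖g‖ ≤ r ↔ ∀ w : W f, ‖w‖ ≤ 1 → |pairing f g w| ≤ r := by
  refine ⟨fun hg w hw => (abs_pairing_le g w).trans <|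
    (mul_le_of_le_one_right (norm_nonneg g) hw).trans hg, fun hg => ?_⟩
  have hsign (n : ℕ) : |(SignType.sign (g n) : ℝ)| ≤ 1 := by
    rcases lt_trichotomy (g n) 0 with h | h | h <;> simp [h]
  have hbound : ∀ᶠ N in atTop, ∑ k ∈ Finset.range N, |g k| - ∑' k, |g (k + N)| ≤ r := by
    filter_upwards [(tendsto_sum_nat_add fun k => |basisLimit f k|).eventually_lt_const
      zero_lt_one] with N hN
    obtain ⟨w, hw, hwsign⟩ := exists_mem_W_extending hf0 he hN hsign
    have hhead : ∑ k ∈ Finset.range N, g k * w.1.1 k = ∑ k ∈ Finset.range N, |g k| :=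
      Finset.sum_congr rfl fun k hk => by rw [hwsign k (Finset.mem_range.1 hk), self_mul_sign]
    have htail := abs_tsum_mul_sub_sum_le (N := N) (Ell1.summable_abs g)
      fun k _ => (abs_apply_le_norm w.1 k).trans hw
    have hle : ∑' k, g k * w.1.1 k ≤ r := (le_abs_self _).trans (hg w hw)
    rw [hhead, mul_one] at htail
    linarith [(abs_le.1 htail).1]
  refine le_of_tendsto ?_ hbound
  simpa [Ell1.norm_eq_tsum_abs] using (Ell1.summable_abs g).hasSum.tendsto_sum_nat.sub
    (tendsto_sum_nat_add fun k => |g k|)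

theorem pairing_injective (hf0 : f 0 ≠ 0) (he : ‖basisLimit f‖ ≤ 1) :
    Function.Injective (pairing f) := by
  refine (injective_iff_map_eq_zero _).2 fun g hg => norm_le_zero_iff.1 ?_
  exact (norm_le_iff_forall_abs_pairing_le hf0 he).2 fun w _ => by simp [hg]

theorem t2Space_sigmaTopology (hf0 : f 0 ≠ 0) (he : ‖basisLimit f‖ ≤ 1) :
    @T2Space Ell1 (sigmaTopology f) :=
  (WeakBilin.isEmbedding (pairing_injective hf0 he)).t2Space

theorem isClosed_sigma_closedBall (hf0 : f 0 ≠ 0) (he : ‖basisLimit f‖ ≤ 1) (z : Ell1) (r : ℝ) :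
    IsClosed[sigmaTopology f] {y | ‖z - y‖ ≤ r} := by
  let _ := sigmaTopology f
  simp only [norm_le_iff_forall_abs_pairing_le hf0 he, map_sub, LinearMap.sub_apply,
    Set.ofPred_forall]
  exact isClosed_iInter fun w => isClosed_iInter fun _ =>
    isClosed_le (continuous_const.sub (WeakBilin.eval_continuous (pairing f) w)).abs
      continuous_const

theorem exists_forall_abs_le_of_pointwise_bounded {ι E : Type*} [NormedAddCommGroup E]
    [NormedSpace ℝ E] [CompleteSpace E] (P : ι → E →ₗ[ℝ] ℝ) (b : ι → ℝ)
    (hb : ∀ i x, |P i x| ≤ b i * ‖x‖)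
    (hP : ∀ x, ∃ c, ∀ i, |P i x| ≤ c) : ∃ M, ∀ i x, ‖x‖ ≤ 1 → |P i x| ≤ M := by
  obtain ⟨M, hM⟩ := banach_steinhaus (g := fun i => (P i).mkContinuous (b i) (hb i)) hP
  exact ⟨M, fun i x hx => (ContinuousLinearMap.unit_le_opNorm _ x hx).trans (hM i)⟩

theorem exists_norm_le_of_isCompact_sigma (hf0 : f 0 ≠ 0) (he : ‖basisLimit f‖ ≤ 1)
    {C : Set Ell1} (hC : @IsCompact Ell1 (sigmaTopology f) C) : ∃ M, ∀ g ∈ C, ‖g‖ ≤ M := by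
  have hpointwise (w : W f) : ∃ b, ∀ g : C, |pairing f g w| ≤ b := by
    obtain ⟨b, hb⟩ := (@IsCompact.image _ _ (sigmaTopology f) _ _ _ hC
      (WeakBilin.eval_continuous (pairing f) w)).isBounded.exists_norm_le
    exact ⟨b, fun g => hb _ ⟨g, g.2, rfl⟩⟩
  obtain ⟨M, hM⟩ := @exists_forall_abs_le_of_pointwise_bounded C (W f) _
    (Submodule.normedSpace (W f)) _ (fun g => pairing f g) (fun g => ‖(g : Ell1)‖)
    (fun g => abs_pairing_le g) hpointwise
  exact ⟨M, fun g hg => (norm_le_iff_forall_abs_pairing_le hf0 he).2 (hM ⟨g, hg⟩)⟩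

end Duality

section SigmaConvergence

variable {f : Ell1} {ι : Type*} {F : Filter ι} {x : ι → Ell1} {z : Ell1} {s M : ℝ}

theorem pairing_basisLimit (hf0 : f 0 ≠ 0) (w : W f) : pairing f (basisLimit f) w = seqLim w.1 :=
  (mem_W_iff hf0 w.1).1 w.2

theorem pairing_eq_tsum_mul_sub_seqLim_add (g : Ell1) (w : W f) :
    pairing f g w = ∑' k, g k * (w.1.1 k - seqLim w.1) + Ell1.mass g * seqLim w.1 := by
  have hg := Ell1.summable_abs g
  simp only [mul_sub]
  rw [(summable_mul_of_abs_le hg (abs_apply_le_norm w.1)).tsum_sub (hg.of_abs.mul_right _),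
    tsum_mul_right, Ell1.mass_apply, sub_add_cancel]
  rfl

theorem tendsto_sigma (hf0 : f 0 ≠ 0) (he : ‖basisLimit f‖ ≤ 1) (hM : ∀ᶠ i in F, ‖x i‖ ≤ M)
    (hx : ∀ k, Tendsto (fun i => x i k) F (𝓝 (z k)))
    (hs : Tendsto (fun i => Ell1.mass (x i - z)) F (𝓝 s)) :
    Tendsto x F (@nhds Ell1 (sigmaTopology f) (z + s • basisLimit f)) := by
  refine (WeakBilin.tendsto_iff_forall_eval_tendsto (pairing f)
    (pairing_injective hf0 he)).2 fun w => ?_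
  have hbound : ∀ᶠ i in F, ‖x i - z‖ ≤ M + ‖z‖ :=
    hM.mono fun i hi => (norm_sub_le _ _).trans (add_le_add_left hi _)
  have hcoord (k : ℕ) : Tendsto (fun i => (x i - z) k) F (𝓝 0) :=
    tendsto_sub_nhds_zero_iff.2 (hx k)
  have hw : Tendsto (fun k => w.1.1 k - seqLim w.1) atTop (𝓝 0) :=
    tendsto_sub_nhds_zero_iff.2 (tendsto_seqLim w.1)
  have hpair : Tendsto (fun i => pairing f (x i - z) w) F (𝓝 (s * seqLim w.1)) := by
    simp only [pairing_eq_tsum_mul_sub_seqLim_add]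
    simpa only [zero_add] using
      (Ell1.tendsto_tsum_mul_of_tendsto_zero hbound hcoord hw).add (hs.mul_const (seqLim w.1))
  simpa [pairing_basisLimit hf0] using hpair.const_add (pairing f z w)

end SigmaConvergence

section MinimalInvariantSets

variable {X : Type*}

/-- `K` is a nonempty `τ`-closed convex set which `T` maps into itself; minimal such sets are the
objects of the Goebel–Karlovitz argument. -/
structure IsClosedConvexInvariant [AddCommGroup X] [Module ℝ X] (τ : TopologicalSpace X)
    (T : X → X) (K : Set X) : Prop where
  nonempty : K.Nonempty
  isClosed : IsClosed[τ] K
  convex : Convex ℝ K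
  mapsTo : Set.MapsTo T K K

theorem IsClosedConvexInvariant.exists_minimal_subset [AddCommGroup X] [Module ℝ X]
    [τ : TopologicalSpace X] {C : Set X} {T : X → X} (h : IsClosedConvexInvariant τ T C)
    (hC : IsCompact C) : ∃ K ⊆ C, Minimal (IsClosedConvexInvariant τ T) K := by
  obtain ⟨K, hKC, ⟨-, hK⟩, hmin⟩ : ∃ K ⊆ C, Minimal
      (· ∈ {K | K ⊆ C ∧ IsClosedConvexInvariant τ T K}) K := by
    refine zorn_superset_nonempty _ (fun c hcS hc hne => ?_) C ⟨subset_rfl, h⟩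
    have : Nonempty c := hne.to_subtype
    obtain ⟨K₀, hK₀⟩ := hne
    refine ⟨⋂₀ c, ⟨(Set.sInter_subset_of_mem hK₀).trans (hcS hK₀).1, ?_,
      isClosed_sInter fun K hK => (hcS hK).2.isClosed,
      convex_sInter fun K hK => (hcS hK).2.convex,
      fun x hx K hK => (hcS hK).2.mapsTo (hx K hK)⟩, fun K hK => Set.sInter_subset_of_mem hK⟩
    exact IsCompact.nonempty_sInter_of_directed_nonempty_isCompact_isClosed
      (fun A hA B hB => (hc.total hA hB).elim (fun h => ⟨A, hA, subset_rfl, h⟩)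
        fun h => ⟨B, hB, h, subset_rfl⟩)
      (fun K hK => (hcS hK).2.nonempty)
      (fun K hK => hC.of_isClosed_subset (hcS hK).2.isClosed (hcS hK).1)
      fun K hK => (hcS hK).2.isClosed
  exact ⟨K, hKC, hK, fun K' hK' hle => hmin ⟨hle.trans hKC, hK'⟩ hle⟩

variable [SeminormedAddCommGroup X] [NormedSpace ℝ X] {K : Set X} {T : X → X}

theorem norm_sub_eq_of_minimal {τ : TopologicalSpace X}
    (hK : Minimal (IsClosedConvexInvariant τ T) K) {z : X}
    (hball : ∀ r, IsClosed[τ] {y | ‖z - y‖ ≤ r}) (hT : ∀ y ∈ K, ‖z - T y‖ ≤ ‖z - y‖)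
    {u v : X} (hu : u ∈ K) (hv : v ∈ K) : ‖z - u‖ = ‖z - v‖ := by
  have hle {u v : X} (hu : u ∈ K) (hv : v ∈ K) : ‖z - v‖ ≤ ‖z - u‖ := by
    have hconvex : Convex ℝ {y | ‖z - y‖ ≤ ‖z - u‖} := by
      simpa only [Metric.closedBall, dist_comm _ z, dist_eq_norm] using
        convex_closedBall z ‖z - u‖
    have hinv : IsClosedConvexInvariant τ T (K ∩ {y | ‖z - y‖ ≤ ‖z - u‖}) :=
      { nonempty := ⟨u, hu, (le_rfl : ‖z - u‖ ≤ ‖z - u‖)⟩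
        isClosed := hK.prop.isClosed.inter (hball _)
        convex := hK.prop.convex.inter hconvex
        mapsTo := fun y hy => ⟨hK.prop.mapsTo hy.1, (hT y hy.1).trans hy.2⟩ }
    exact (hK.le_of_le hinv Set.inter_subset_left hv).2
  exact le_antisymm (hle hv hu) (hle hu hv)

theorem exists_dist_map_lt_of_lipschitzWith_lt_one {α : Type*} [PseudoMetricSpace α] [Nonempty α]
    {S : α → α} {q : ℝ≥0} (hS : LipschitzWith q S) (hq : q < 1) {ε : ℝ} (hε : 0 < ε) :
    ∃ x, dist x (S x) < ε := by
  obtain ⟨x₀⟩ := ‹Nonempty α›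
  have hlim : Tendsto (fun n : ℕ => dist x₀ (S x₀) * (q : ℝ) ^ n) atTop (𝓝 0) := by
    simpa using (tendsto_pow_atTop_nhds_zero_of_lt_one q.2 hq).const_mul (dist x₀ (S x₀))
  obtain ⟨n, hn⟩ := (hlim.eventually_lt_const hε).exists
  refine ⟨S^[n] x₀, ?_⟩
  rw [← Function.iterate_succ_apply' S n]
  exact (hS.dist_iterate_succ_le_geometric x₀ n).trans_lt hn

theorem exists_norm_sub_map_lt (hne : K.Nonempty) (hconv : Convex ℝ K)
    (hb : Bornology.IsBounded K) (hT : Set.MapsTo T K K)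
    (hTn : ∀ x ∈ K, ∀ y ∈ K, ‖T x - T y‖ ≤ ‖x - y‖) {ε : ℝ} (hε : 0 < ε) :
    ∃ x ∈ K, ‖x - T x‖ < ε := by
  obtain ⟨x₀, hx₀⟩ := hne
  have : Nonempty K := ⟨⟨x₀, hx₀⟩⟩
  obtain ⟨t, ⟨ht0, ht⟩, ht1⟩ : ∃ t : ℝ, (0 < t ∧ Metric.diam K * t < ε / 2) ∧ t ≤ 1 := by
    obtain ⟨t, ht0, ht⟩ := exists_pos_mul_lt (half_pos hε) (Metric.diam K)
    exact ⟨min t 1, ⟨lt_min ht0 one_pos, (mul_le_mul_of_nonneg_left (min_le_left t 1)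
      Metric.diam_nonneg).trans_lt ht⟩, min_le_right t 1⟩
  let S (x : K) : K := ⟨AffineMap.lineMap (T x) x₀ t,
    hconv.lineMap_mem (hT x.2) hx₀ ⟨ht0.le, ht1⟩⟩
  have hS : LipschitzWith (1 - t).toNNReal S := LipschitzWith.of_dist_le_mul fun x y => by
    rw [Real.coe_toNNReal _ (sub_nonneg.2 ht1), Subtype.dist_eq, dist_eq_norm]
    have hxy : (S x : X) - S y = (1 - t) • (T x - T y) := by
      simp only [S, AffineMap.lineMap_apply_module]
      module
    rw [hxy, norm_smul, Real.norm_of_nonneg (sub_nonneg.2 ht1)]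
    exact mul_le_mul_of_nonneg_left
      ((hTn x x.2 y y.2).trans_eq (dist_eq_norm (x : X) y).symm) (sub_nonneg.2 ht1)
  obtain ⟨x, hx⟩ := exists_dist_map_lt_of_lipschitzWith_lt_one hS
    (Real.toNNReal_lt_one.2 (by linarith)) (half_pos hε)
  have hST : dist (S x : X) (T x) < ε / 2 := by
    calc dist (S x : X) (T x) = t * dist (T x) x₀ := by
          rw [dist_lineMap_left, Real.norm_of_nonneg ht0.le]
      _ ≤ t * Metric.diam K := by
          gcongr
          exact Metric.dist_le_diam_of_mem hb (hT x.2) hx₀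
      _ < ε / 2 := by rwa [mul_comm]
  refine ⟨x, x.2, ?_⟩
  rw [← dist_eq_norm]
  calc dist (x : X) (T x) ≤ dist (x : X) (S x) + dist (S x : X) (T x) := dist_triangle _ _ _
    _ < ε := by linarith [Subtype.dist_eq x (S x)]

end MinimalInvariantSets

theorem hasFPP_iff {X : Type*} [NormedAddCommGroup X] {C : Set X} :
    HasFPP C ↔ ∀ T : X → X, Set.MapsTo T C C → (∀ x ∈ C, ∀ y ∈ C, ‖T x - T y‖ ≤ ‖x - y‖) →
      ∃ x ∈ C, T x = x := by
  constructor
  · intro h T hT hTn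
    obtain ⟨x, hx⟩ := h (hT.restrict T C C) fun x y => hTn x x.2 y y.2
    exact ⟨x, x.2, congrArg Subtype.val hx⟩
  · intro h T hTn
    let S : X → X := Function.extend Subtype.val (fun x => (T x : X)) id
    have hS (x : C) : S x = T x := Subtype.val_injective.extend_apply _ _ x
    obtain ⟨x, hxC, hx⟩ := h S (fun x hx => hS ⟨x, hx⟩ ▸ (T ⟨x, hx⟩).2)
      fun x hx y hy => by rw [hS ⟨x, hx⟩, hS ⟨y, hy⟩]; exact hTn ⟨x, hx⟩ ⟨y, hy⟩
    exact ⟨⟨x, hxC⟩, Subtype.ext ((hS ⟨x, hxC⟩).symm.trans hx)⟩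

section MinimalSetsInEll1

variable {f : Ell1} {ι : Type*} {F : Filter ι} [F.NeBot] {x d : ι → Ell1} {e z : Ell1} {s : ℝ}

theorem norm_sub_map_le_of_approx_fixed {T : Ell1 → Ell1}
    (hx : ∀ k, Tendsto (fun i => x i k) F (𝓝 (z k)))
    (hxT : Tendsto (fun i => ‖x i - T (x i)‖) F (𝓝 0)) {y : Ell1}
    (hT : ∀ i, ‖T (x i) - T y‖ ≤ ‖x i - y‖) : ‖z - T y‖ ≤ ‖z - y‖ := by
  have hlim : Tendsto (fun i => ‖x i - y‖ - ‖x i - z‖ + ‖x i - T (x i)‖) F (𝓝 ‖z - y‖) := by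
    simpa using (Ell1.tendsto_norm_sub_sub_norm_sub hx y).add hxT
  refine le_of_tendsto_of_tendsto (Ell1.tendsto_norm_sub_sub_norm_sub hx (T y)) hlim
    (Eventually.of_forall fun i => ?_)
  have htri := norm_sub_le_norm_sub_add_norm_sub (x i) (T (x i)) (T y)
  dsimp only
  linarith [hT i]

theorem mass_limit_eq_zero_of_norm_lt_one (hs : Tendsto (fun i => Ell1.mass (d i)) F (𝓝 s))
    (hd : ∀ i, ‖d i‖ = ‖s • e‖) (he : ‖e‖ < 1) : s = 0 := by
  have hle : |s| ≤ |s| * ‖e‖ := le_of_tendsto hs.abs <| Eventually.of_forall fun i => by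
    simpa only [hd, norm_smul, Real.norm_eq_abs] using Ell1.abs_mass_le_norm (d i)
  by_contra hs0
  exact hle.not_gt (mul_lt_of_lt_one_right (abs_pos.2 hs0) he)

theorem mass_limit_eq_zero_of_finite_nonneg
    (hs : Tendsto (fun i => Ell1.mass (d i)) F (𝓝 s))
    (hd : ∀ k, Tendsto (fun i => d i k) F (𝓝 0)) (hadd : ∀ i, ‖s • e + d i‖ = ‖s • e‖ + ‖d i‖)
    (hfin : {k | 0 ≤ e k}.Finite) : s = 0 := by
  have hneg (i : ι) (k : ℕ) (hk : k ∉ hfin.toFinset) : s * d i k ≤ 0 := by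
    have hek : e k < 0 := by simpa using hk
    have hsign : 0 ≤ e k * (s * d i k) := by
      simpa [mul_left_comm, mul_assoc] using Ell1.mul_nonneg_of_norm_add_eq (hadd i) k
    exact nonpos_of_mul_nonneg_right hsign hek
  have hsum (i : ι) : s * Ell1.mass (d i) ≤ ∑ k ∈ hfin.toFinset, s * d i k := by
    have h := ((Ell1.summable_abs (d i)).of_abs.mul_left s).neg.sum_le_tsum hfin.toFinset
      fun k hk => neg_nonneg.2 (hneg i k hk)
    rwa [Finset.sum_neg_distrib, tsum_neg, neg_le_neg_iff, tsum_mul_left] at h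
  have hlim : Tendsto (fun i => ∑ k ∈ hfin.toFinset, s * d i k) F (𝓝 0) := by
    simpa using tendsto_finsetSum hfin.toFinset fun k _ => (hd k).const_mul s
  exact mul_self_eq_zero.1 ((le_of_tendsto_of_tendsto' (hs.const_mul s) hlim hsum).antisymm
    (mul_self_nonneg s))

theorem exists_fixedPoint_of_minimal (hf0 : f 0 ≠ 0) (he : ‖basisLimit f‖ ≤ 1)
    (hcond : ‖basisLimit f‖ < 1 ∨ {n | 0 ≤ basisLimit f n}.Finite) {K : Set Ell1}
    {T : Ell1 → Ell1} (hK : Minimal (IsClosedConvexInvariant (sigmaTopology f) T) K)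
    (hb : Bornology.IsBounded K) (hT : ∀ x ∈ K, ∀ y ∈ K, ‖T x - T y‖ ≤ ‖x - y‖) :
    ∃ x ∈ K, T x = x := by
  obtain ⟨hne, hclosed, hconv, hmaps⟩ := hK.prop
  obtain ⟨M, hM⟩ := hb.exists_norm_le
  choose x hxK hxT using fun n : ℕ =>
    exists_norm_sub_map_lt hne hconv hb hmaps hT (Nat.one_div_pos_of_nat (α := ℝ) (n := n))
  let U : Ultrafilter ℕ := hyperfilter ℕ
  have hxT0 : Tendsto (fun n => ‖x n - T (x n)‖) U (𝓝 0) :=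
    (squeeze_zero (fun _ => norm_nonneg _) (fun n => (hxT n).le)
      tendsto_one_div_add_atTop_nhds_zero_nat).mono_left Nat.hyperfilter_le_atTop
  have hxM : ∀ᶠ n in U, ‖x n‖ ≤ M := Eventually.of_forall fun n => hM _ (hxK n)
  obtain ⟨z, s, hz, hs⟩ := Ell1.exists_coordinatewise_limit U hxM
  set g := z + s • basisLimit f with hg
  have hgK : g ∈ K := @IsClosed.mem_of_tendsto _ (sigmaTopology f) _ _ _ _ _ _ hclosed
    (tendsto_sigma hf0 he hxM hz hs) (Eventually.of_forall hxK)
  have hconst {v : Ell1} (hv : v ∈ K) : ‖z - v‖ = ‖s • basisLimit f‖ := by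
    rw [norm_sub_eq_of_minimal hK (isClosed_sigma_closedBall hf0 he z)
      (fun y hy => norm_sub_map_le_of_approx_fixed hz hxT0 fun n => hT _ (hxK n) y hy) hv hgK,
      hg, sub_add_cancel_left, norm_neg]
  have hd (n : ℕ) : ‖x n - z‖ = ‖s • basisLimit f‖ := by rw [norm_sub_rev, hconst (hxK n)]
  have hadd (n : ℕ) : ‖s • basisLimit f + (x n - z)‖ = ‖s • basisLimit f‖ + ‖x n - z‖ := by
    have hmid : z - midpoint ℝ g (x n) = -(2⁻¹ : ℝ) • (s • basisLimit f + (x n - z)) := by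
      rw [midpoint_eq_smul_add, hg, invOf_eq_inv]
      module
    have h := hconst (hconv.midpoint_mem hgK (hxK n))
    rw [hmid, norm_smul, norm_neg, norm_inv, Real.norm_two] at h
    linarith [hd n]
  have hs0 : s = 0 := hcond.elim (mass_limit_eq_zero_of_norm_lt_one hs hd)
    (mass_limit_eq_zero_of_finite_nonneg hs (fun k => tendsto_sub_nhds_zero_iff.2 (hz k)) hadd)
  have hKz {v : Ell1} (hv : v ∈ K) : z = v := by simpa [hs0, sub_eq_zero] using hconst hv
  exact ⟨g, hgK, (hKz (hmaps hgK)).symm.trans (hKz hgK)⟩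

theorem hasSigmaFPP_of_basisLimit (hf0 : f 0 ≠ 0) (he : ‖basisLimit f‖ ≤ 1)
    (hcond : ‖basisLimit f‖ < 1 ∨ {n | 0 ≤ basisLimit f n}.Finite) : HasSigmaFPP f := by
  refine fun C hne hconv hC => hasFPP_iff.2 fun T hmaps hT => ?_
  have hclosed : IsClosed[sigmaTopology f] C :=
    @IsCompact.isClosed _ (sigmaTopology f) (t2Space_sigmaTopology hf0 he) _ hC
  obtain ⟨K, hKC, hK⟩ := @IsClosedConvexInvariant.exists_minimal_subset _ _ _ (sigmaTopology f)
    _ _ ⟨hne, hclosed, hconv, hmaps⟩ hC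
  have hb : Bornology.IsBounded C :=
    isBounded_iff_forall_norm_le.2 (exists_norm_le_of_isCompact_sigma hf0 he hC)
  obtain ⟨x, hx, hfix⟩ := exists_fixedPoint_of_minimal hf0 he hcond hK (hb.subset hKC)
    fun x hx y hy => hT x (hKC hx) y (hKC hy)
  exact ⟨x, hKC hx, hfix⟩

end MinimalSetsInEll1

section Subsequences

theorem hasSum_abs_extend_zero {ν : ℕ → ℕ} (hν : ν.Injective) (m : Ell1) :
    HasSum (fun n => |Function.extend ν m 0 n|) ‖m‖ := by
  have h : (fun n => |Function.extend ν m 0 n|) = Function.extend ν (fun k => |m k|) 0 := by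
    ext n
    rw [Function.apply_extend abs]
    congr 1
    exact funext fun _ => abs_zero
  rw [h, Ell1.norm_eq_tsum_abs]
  exact (hasSum_extend_zero hν).2 (Ell1.summable_abs m).hasSum

variable {ν : ℕ → ℕ} (hν : ν.Injective)

/-- The isometric embedding of `ℓ₁` into itself which sends the `k`-th basis vector to the
`ν k`-th one. -/
def spread : Ell1 →ₗᵢ[ℝ] Ell1 where
  toFun m := Ell1.ofSummable (Function.extend ν m 0) (hasSum_abs_extend_zero hν m).summable
  map_add' m m' := lp.ext <| by
    simp only [lp.coeFn_add, Ell1.coe_ofSummable, ← Function.extend_add, add_zero]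
  map_smul' r m := lp.ext <| by
    simp only [lp.coeFn_smul, Ell1.coe_ofSummable, ← Function.extend_smul, smul_zero,
      RingHom.id_apply]
  norm_map' m := (Ell1.norm_eq_tsum_abs _).trans (hasSum_abs_extend_zero hν m).tsum_eq

theorem spread_apply (m : Ell1) (k : ℕ) : spread hν m (ν k) = m k := hν.extend_apply _ _ k

theorem spread_apply_of_notMem_range (m : Ell1) {n : ℕ} (hn : n ∉ Set.range ν) :
    spread hν m n = 0 :=
  Function.extend_apply' _ _ _ hn

theorem tendsto_spread_apply {ι : Type*} {F : Filter ι} {m : ι → Ell1} {z : Ell1}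
    (hz : ∀ k, Tendsto (fun i => m i k) F (𝓝 (z k))) (n : ℕ) :
    Tendsto (fun i => spread hν (m i) n) F (𝓝 (spread hν z n)) := by
  by_cases hn : n ∈ Set.range ν
  · obtain ⟨k, rfl⟩ := hn
    simpa only [spread_apply] using hz k
  · simpa only [spread_apply_of_notMem_range hν _ hn] using tendsto_const_nhds

theorem mass_spread (m : Ell1) : Ell1.mass (spread hν m) = Ell1.mass m :=
  ((hasSum_extend_zero hν).2 (Ell1.summable_abs m).of_abs.hasSum).tsum_eq

/-- Restriction of a sequence to the indices `ν k`. -/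
def subseq : Ell1 →ₗ[ℝ] Ell1 where
  toFun x := Ell1.ofSummable (fun k => x (ν k)) ((Ell1.summable_abs x).comp_injective hν)
  map_add' _ _ := rfl
  map_smul' _ _ := rfl

theorem subseq_apply (x : Ell1) (k : ℕ) : subseq hν x k = x (ν k) := rfl

theorem subseq_spread (m : Ell1) : subseq hν (spread hν m) = m :=
  lp.ext <| funext <| spread_apply hν m

theorem norm_eq_norm_subseq_add (x : Ell1) :
    ‖x‖ = ‖subseq hν x‖ + ‖x - spread hν (subseq hν x)‖ := by
  rw [← (spread hν).norm_map (subseq hν x)]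
  simp only [Ell1.norm_eq_tsum_abs]
  rw [← (Ell1.summable_abs _).tsum_add (Ell1.summable_abs _)]
  refine tsum_congr fun n => ?_
  change |x n| = |spread hν (subseq hν x) n| + |x n - spread hν (subseq hν x) n|
  by_cases hn : n ∈ Set.range ν
  · obtain ⟨k, rfl⟩ := hn
    simp [spread_apply, subseq_apply]
  · simp [spread_apply_of_notMem_range hν _ hn]

end Subsequences

section Barycenters

/-- The sequences of nonnegative weights of total mass at most one. -/
def subProb : Set Ell1 := {m | (∀ k, 0 ≤ m k) ∧ Ell1.mass m ≤ 1}

theorem convex_subProb : Convex ℝ subProb := by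
  rintro m ⟨hm, hm1⟩ m' ⟨hm', hm1'⟩ a b ha hb hab
  refine ⟨fun k => add_nonneg (mul_nonneg ha (hm k)) (mul_nonneg hb (hm' k)), ?_⟩
  rw [map_add, map_smul, map_smul]
  exact convex_Iic (1 : ℝ) hm1 hm1' ha hb hab

theorem norm_le_one_of_mem_subProb {m : Ell1} (hm : m ∈ subProb) : ‖m‖ ≤ 1 :=
  (Ell1.norm_eq_mass hm.1).trans_le hm.2

theorem mem_subProb_of_tendsto {ι : Type*} {F : Filter ι} [F.NeBot] {m : ι → Ell1} {z : Ell1}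
    (hm : ∀ᶠ i in F, m i ∈ subProb) (hz : ∀ k, Tendsto (fun i => m i k) F (𝓝 (z k))) :
    z ∈ subProb := by
  have hpos (k : ℕ) : 0 ≤ z k := ge_of_tendsto (hz k) (hm.mono fun i hi => hi.1 k)
  refine ⟨hpos, (Ell1.norm_eq_mass hpos).symm.trans_le ?_⟩
  exact lp.norm_le_of_tendsto (hm.mono fun i hi => norm_le_one_of_mem_subProb hi)
    (tendsto_pi_nhds.2 hz)

variable {ν : ℕ → ℕ} (hν : ν.Injective) {f : Ell1}

/-- The affine map which puts weight `m k` on the `ν k`-th basis vector of `ℓ₁` and the remaining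
weight `1 - mass m` on `e`. -/
def barycenter (e : Ell1) : Ell1 →ᵃ[ℝ] Ell1 :=
  AffineMap.const ℝ Ell1 e +
    ((spread hν).toLinearMap - Ell1.mass.toLinearMap.smulRight e).toAffineMap

theorem barycenter_apply (e m : Ell1) :
    barycenter hν e m = (1 - Ell1.mass m) • e + spread hν m := by
  change e + (spread hν m - Ell1.mass m • e) = _
  module

theorem tendsto_sigma_barycenter (hf0 : f 0 ≠ 0) (he : ‖basisLimit f‖ ≤ 1) {ι : Type*}
    {F : Filter ι} {m : ι → Ell1} {z : Ell1} {s M : ℝ} (hM : ∀ᶠ i in F, ‖m i‖ ≤ M)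
    (hz : ∀ k, Tendsto (fun i => m i k) F (𝓝 (z k)))
    (hs : Tendsto (fun i => Ell1.mass (m i - z)) F (𝓝 s)) :
    Tendsto (fun i => barycenter hν (basisLimit f) (m i)) F
      (@nhds Ell1 (sigmaTopology f) (barycenter hν (basisLimit f) z)) := by
  set e := basisLimit f
  have hmass : Tendsto (fun i => 1 - Ell1.mass (m i)) F (𝓝 (1 - (Ell1.mass z + s))) := by
    simpa using (hs.const_add (Ell1.mass z)).const_sub 1
  let y : Ell1 := (1 - (Ell1.mass z + s)) • e + spread hν z
  have hcoord (n : ℕ) : Tendsto (fun i => barycenter hν e (m i) n) F (𝓝 (y n)) := by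
    simp only [barycenter_apply]
    exact (hmass.mul_const (e n)).add (tendsto_spread_apply hν hz n)
  have hlost : Tendsto (fun i => Ell1.mass (barycenter hν e (m i) - y)) F (𝓝 s) := by
    have h := ((hmass.sub_const (1 - (Ell1.mass z + s))).mul_const (Ell1.mass e)).add hs
    simpa [barycenter_apply, y, mass_spread, sub_mul, add_sub_add_comm] using h
  have hbound : ∀ᶠ i in F, ‖barycenter hν e (m i)‖ ≤ (1 + M) * ‖e‖ + M := by
    filter_upwards [hM] with i hi
    have hmass_le : |1 - Ell1.mass (m i)| ≤ 1 + M := by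
      calc |1 - Ell1.mass (m i)| ≤ |1| + |Ell1.mass (m i)| := abs_sub _ _
        _ ≤ 1 + M := by
          rw [abs_one]
          gcongr
          exact (Ell1.abs_mass_le_norm (m i)).trans hi
    calc ‖barycenter hν e (m i)‖ ≤ ‖(1 - Ell1.mass (m i)) • e‖ + ‖spread hν (m i)‖ := by
          rw [barycenter_apply]
          exact norm_add_le _ _
      _ = |1 - Ell1.mass (m i)| * ‖e‖ + ‖m i‖ := by
          rw [norm_smul, LinearIsometry.norm_map, Real.norm_eq_abs]
      _ ≤ (1 + M) * ‖e‖ + M := by gcongr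
  have hy : y + s • e = barycenter hν e z := by
    rw [barycenter_apply]
    module
  exact hy ▸ tendsto_sigma hf0 he hbound hcoord hlost

theorem isCompact_sigma_barycenter_image (hf0 : f 0 ≠ 0) (he : ‖basisLimit f‖ ≤ 1) :
    @IsCompact Ell1 (sigmaTopology f) (barycenter hν (basisLimit f) '' subProb) := by
  refine (@isCompact_iff_ultrafilter_le_nhds' _ (sigmaTopology f) _).2 fun U hU => ?_
  choose! m hm hmx using fun x (hx : x ∈ barycenter hν (basisLimit f) '' subProb) => hx
  have hmU : ∀ᶠ x in U, m x ∈ subProb := mem_of_superset hU hm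
  have hM : ∀ᶠ x in U, ‖m x‖ ≤ 1 := hmU.mono fun x hx => norm_le_one_of_mem_subProb hx
  obtain ⟨z, s, hz, hs⟩ := Ell1.exists_coordinatewise_limit U hM
  refine ⟨_, ⟨z, mem_subProb_of_tendsto hmU hz, rfl⟩, ?_⟩
  exact (tendsto_sigma_barycenter hν hf0 he hM hz hs).congr' (mem_of_superset hU hmx)

end Barycenters

section FixedPointFreeIsometry

/-- The sequence `m` preceded by the entry `1 - mass m`, which makes the total mass one. -/
def prependDeficit (m : Ell1) : Ell1 :=
  Ell1.ofSummable (fun | 0 => 1 - Ell1.mass m | k + 1 => m k)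
    ((summable_nat_add_iff 1).1 (Ell1.summable_abs m))

theorem prependDeficit_zero (m : Ell1) : prependDeficit m 0 = 1 - Ell1.mass m := rfl

theorem prependDeficit_succ (m : Ell1) (k : ℕ) : prependDeficit m (k + 1) = m k := rfl

theorem mass_prependDeficit (m : Ell1) : Ell1.mass (prependDeficit m) = 1 := by
  rw [Ell1.mass_apply, (Ell1.summable_abs _).of_abs.tsum_eq_zero_add]
  simp only [prependDeficit_zero, prependDeficit_succ, Ell1.mass_apply, sub_add_cancel]

theorem norm_prependDeficit_sub (m m' : Ell1) :
    ‖prependDeficit m - prependDeficit m'‖ =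
      |(1 - Ell1.mass m) - (1 - Ell1.mass m')| + ‖m - m'‖ := by
  rw [Ell1.norm_eq_abs_add, Ell1.norm_eq_tsum_abs (m - m')]
  rfl

theorem prependDeficit_ne_self (m : Ell1) : prependDeficit m ≠ m := by
  intro h
  have hconst (k : ℕ) : m k = m 0 := by
    induction k with
    | zero => rfl
    | succ k ih => rw [← ih, ← prependDeficit_succ m k, h]
  have hzero : m 0 = 0 := by
    have hlim := (Ell1.summable_abs m).of_abs.tendsto_atTop_zero
    rw [funext hconst] at hlim
    exact tendsto_nhds_unique tendsto_const_nhds hlim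
  have hm : m = 0 := lp.ext <| funext fun k => (hconst k).trans hzero
  have h0 := prependDeficit_zero m
  rw [h, hm, map_zero] at h0
  norm_num at h0

variable {ν : ℕ → ℕ} (hν : ν.Injective) {e : Ell1}

theorem subseq_barycenter (e m : Ell1) :
    subseq hν (barycenter hν e m) = (1 - Ell1.mass m) • subseq hν e + m := by
  rw [barycenter_apply, map_add, map_smul, subseq_spread]

theorem barycenter_sub_spread_subseq (e m : Ell1) :
    barycenter hν e m - spread hν (subseq hν (barycenter hν e m)) =
      (1 - Ell1.mass m) • (e - spread hν (subseq hν e)) := by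
  rw [subseq_barycenter, barycenter_apply, map_add, map_smul]
  module

theorem one_sub_mass_subseq_barycenter (he : ‖e‖ = 1) (hpos : ∀ k, 0 ≤ e (ν k)) (m : Ell1) :
    1 - Ell1.mass (subseq hν (barycenter hν e m)) =
      (1 - Ell1.mass m) * ‖e - spread hν (subseq hν e)‖ := by
  have hnorm := norm_eq_norm_subseq_add hν e
  rw [he, Ell1.norm_eq_mass (g := subseq hν e) hpos] at hnorm
  rw [subseq_barycenter, map_add, map_smul, smul_eq_mul]
  linear_combination (1 - Ell1.mass m) * hnorm

/-- A shift along `ν` which fixes no point: the entries of `x` along `ν` are moved one step further,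
the first one becomes `1 - ∑ x(ν k)`, and the other entries are set to zero. -/
def shiftAlong (x : Ell1) : Ell1 := spread hν (prependDeficit (subseq hν x))

theorem shiftAlong_ne_self (x : Ell1) : shiftAlong hν x ≠ x := fun h =>
  prependDeficit_ne_self (subseq hν x) <| by
    rw [← subseq_spread hν (prependDeficit (subseq hν x)), ← shiftAlong, h]

theorem mapsTo_shiftAlong (he : ‖e‖ = 1) (hpos : ∀ k, 0 ≤ e (ν k)) :
    Set.MapsTo (shiftAlong hν) (barycenter hν e '' subProb) (barycenter hν e '' subProb) := by
  rintro _ ⟨m, ⟨hm, hm1⟩, rfl⟩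
  have hdeficit : 0 ≤ 1 - Ell1.mass m := sub_nonneg.2 hm1
  refine ⟨prependDeficit (subseq hν (barycenter hν e m)),
    ⟨fun k => ?_, (mass_prependDeficit _).le⟩, ?_⟩
  · cases k with
    | zero =>
      rw [prependDeficit_zero, one_sub_mass_subseq_barycenter hν he hpos]
      exact mul_nonneg hdeficit (norm_nonneg _)
    | succ k =>
      rw [prependDeficit_succ, subseq_barycenter]
      exact add_nonneg (mul_nonneg hdeficit (hpos k)) (hm k)
  · rw [barycenter_apply, mass_prependDeficit, sub_self, zero_smul, zero_add, shiftAlong]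

theorem norm_shiftAlong_sub (he : ‖e‖ = 1) (hpos : ∀ k, 0 ≤ e (ν k)) (m m' : Ell1) :
    ‖shiftAlong hν (barycenter hν e m) - shiftAlong hν (barycenter hν e m')‖ =
      ‖barycenter hν e m - barycenter hν e m'‖ := by
  have hrest : barycenter hν e m - barycenter hν e m' -
      spread hν (subseq hν (barycenter hν e m - barycenter hν e m')) =
      (1 - Ell1.mass m - (1 - Ell1.mass m')) • (e - spread hν (subseq hν e)) := by
    rw [map_sub, map_sub, sub_sub_sub_comm, barycenter_sub_spread_subseq,
      barycenter_sub_spread_subseq, ← sub_smul]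
  rw [shiftAlong, shiftAlong, ← map_sub, LinearIsometry.norm_map, norm_prependDeficit_sub,
    norm_eq_norm_subseq_add hν (barycenter hν e m - barycenter hν e m'), hrest, norm_smul,
    one_sub_mass_subseq_barycenter hν he hpos, one_sub_mass_subseq_barycenter hν he hpos,
    ← sub_mul, abs_mul, abs_norm, Real.norm_eq_abs, map_sub, add_comm]

theorem not_hasSigmaFPP {f : Ell1} (hf0 : f 0 ≠ 0) (he : ‖basisLimit f‖ = 1)
    (hinf : {n | 0 ≤ basisLimit f n}.Infinite) : ¬HasSigmaFPP f := by
  intro hFPP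
  have hν := (Nat.nth_strictMono hinf).injective
  have hpos (k : ℕ) : 0 ≤ basisLimit f (Nat.nth (fun n => 0 ≤ basisLimit f n) k) :=
    Nat.nth_mem_of_infinite hinf k
  have hne : subProb.Nonempty := ⟨0, fun _ => le_rfl, (map_zero Ell1.mass).trans_le zero_le_one⟩
  obtain ⟨x, -, hx⟩ := hasFPP_iff.1 (hFPP _ (hne.image _) (convex_subProb.affine_image _)
    (isCompact_sigma_barycenter_image hν hf0 he.le)) (shiftAlong hν)
    (mapsTo_shiftAlong hν he hpos) (by
      rintro _ ⟨m, -, rfl⟩ _ ⟨m', -, rfl⟩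
      exact (norm_shiftAlong_sub hν he hpos m m').le)
  exact shiftAlong_ne_self hν x hx

end FixedPointFreeIsometry

end

end WeakStarFPP

theorem proposition2p2_general (f : WeakStarFPP.Ell1) (hf : f ≠ 0) (hf_ge : ‖f‖ / 2 ≤ |f 0|) :
    WeakStarFPP.HasSigmaFPP f ↔
      (‖f‖ / 2 < |f 0| ∨ (|f 0| = ‖f‖ / 2 ∧ {n : ℕ | f 0 * f (n + 1) ≤ 0}.Finite)) := by
  have hf0 : f 0 ≠ 0 := abs_pos.1 ((half_pos (norm_pos_iff.2 hf)).trans_le hf_ge)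
  have he : ‖WeakStarFPP.basisLimit f‖ ≤ 1 := by
    simpa only [le_iff_lt_or_eq, WeakStarFPP.norm_basisLimit_lt_one_iff hf0,
      WeakStarFPP.norm_basisLimit_eq_one_iff hf0, eq_comm] using hf_ge
  simp only [← WeakStarFPP.norm_basisLimit_lt_one_iff hf0,
    ← WeakStarFPP.norm_basisLimit_eq_one_iff hf0, ← WeakStarFPP.basisLimit_nonneg_iff hf0]
  constructor
  · intro hFPP
    refine he.lt_or_eq.imp_right fun heq => ⟨heq, ?_⟩
    by_contra hinf
    exact WeakStarFPP.not_hasSigmaFPP hf0 heq hinf hFPP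
  · exact fun h => WeakStarFPP.hasSigmaFPP_of_basisLimit hf0 he (h.imp_right And.right)

theorem proposition2p2 (f : WeakStarFPP.Ell1) (hf : ‖f‖ = 1)
    (hf_ge : 1 / 2 ≤ |f 0|) (hf_lt : |f 0| < 1)
    (hf_tail : ∀ j : ℕ, 1 ≤ j → |f j| < 1 / 2) :
    WeakStarFPP.HasSigmaFPP f ↔
      (1 / 2 < |f 0| ∨ (|f 0| = 1 / 2 ∧ {n : ℕ | f 0 * f (n + 1) ≤ 0}.Finite)) := by
  have hf0 : f ≠ 0 := norm_ne_zero_iff.1 (by rw [hf]; exact one_ne_zero)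
  simpa only [hf] using proposition2p2_general f hf0 (by rwa [hf])
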